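/- Let $\Sigma$ be a finite alphabet and $L\subseteq\Sigma^*$ a regular language. Let $M_L$ be its syntactic monoid and $\eta_L:\Sigma^*\to M_L$ its syntactic morphism. A positive integer $Q$ is a period of $L$ with respect to a non-empty set $\Gamma\subseteq\Sigma$ if, for every $w\in\Sigma^*$ such that $t\cdot\eta_L(w)=t$ for some $t\in M_L$, the number of occurrences in $w$ of letters of $\Gamma$ is a multiple of $Q$. Let $P$ be the maximum period of $L$ with respect to $\Sigma$. Write $C_P=\mathbb Z/P\mathbb Z$ and $\rho(w)=|w| \bmod P$ for $w\in\Sigma^*$; since $P$ is a period of $L$, $\rho$ induces a monoid homomorphism $\overline\rho:M_L\to C_P$ with $\overline\rho(\eta_L(w))=\rho(w)$. For $r\in C_P$ let $N_r=\eta_L(\{w\in\Sigma^*\mid\rho(w)=r\})$, let $K=\max_{r\in C_P}|N_r|$, and let $\theta_r:\{0,\dots,|N_r|-1\}\to N_r$ $(r\in C_P)$ be arbitrary bijections. Let $\mathcal T_K$ be the monoid of all transformations of $\{0,\dots,K-1\}$, with product $\sigma\cdot\tau=\tau\circ\sigma$. For $t\in M_L$ and $r\in C_P$ let $f_t(r)\in\mathcal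 T_K$ be given by \[ f_t(r)(k)=\begin{cases}\theta_{r+\overline\rho(t)}^{-1}(\theta_r(k)\cdot t)&\text{if }k<|N_r|,\\ k&\text{if }k\ge|N_r|,\end{cases}\] and let $\mathbf{Can}(t)=(f_t,\overline\rho(t))$. The residual monoid with residual $r$ is the submonoid \[T_r=\{f(r)\mid (f,0)\in\mathbf{Can}(M_L)\}\subseteq\mathcal T_K.\] For $w\in\Sigma^*$ with $|w|=r<P$ let $L_w=\{u\in(\Sigma^P)^*\mid wu\in L\}$, regarded as a language over the alphabet $\Sigma^P$, and let $\eta_w:(\Sigma^P)^*\to T_r$ be the homomorphism $\eta_w(u)=f(r)$ where $\mathbf{Can}(\eta_L(u))=(f,0)$. For a language $H$ over a finite non-empty alphabet $A$ put $\mu_H(\ell)=|H\cap A^\ell|/|A^\ell|$. An ideal of a monoid $M$ is a subset $I\subseteq M$ with $IM=I=MI$. Then for every $r$ with $0\le r<P$ and every $w\in\Sigma^r$ the limit $\mu_{L_w}=\lim_{\ell\to\infty}\mu_{L_w}(\ell)$ exists (where $\mu_{L_w}(\ell)$ is taken over the alphabet $\Sigma^P$), and the following conditions are equivalent: (i) $\mu_{L_w}=0$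 or $\mu_{L_w}=1$; (ii) there exists a non-empty ideal $I$ of $T_r$ such that $I\cap\eta_w(L_w)=\emptyset$ or $I\subseteq\eta_w(L_w)$. -/

import Mathlib

open Filter Topology

namespace PeriodicLanguage

/-! ### Syntactic monoid -/

/-- The syntactic congruence of `L`: `u ∼ v` iff `x u y ∈ L ↔ x v y ∈ L` for all words `x, y`. -/
def syntacticCon {α : Type*} (L : Language α) : Con (FreeMonoid α) where
  r u v := ∀ x y : FreeMonoid α,
    FreeMonoid.toList (x * u * y) ∈ L ↔ FreeMonoid.toList (x * v * y) ∈ L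
  iseqv := ⟨fun _ _ _ => Iff.rfl, fun h x y => (h x y).symm,
    fun h k x y => (h x y).trans (k x y)⟩
  mul' := by
    intro a b c d h k x y
    have h1 := h x (c * y)
    have h2 := k (x * b) y
    simp only [mul_assoc] at h1 h2 ⊢
    exact h1.trans h2

/-- The syntactic monoid `M_L`. -/
abbrev SyntacticMonoid {α : Type*} (L : Language α) : Type _ := (syntacticCon L).Quotient

/-- The syntactic morphism `η_L : Σ^* → M_L`. -/
def syntacticHom {α : Type*} (L : Language α) : FreeMonoid α →* SyntacticMonoid L :=
  (syntacticCon L).mk'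

theorem syntacticHom_surjective {α : Type*} (L : Language α) :
    Function.Surjective (syntacticHom L) :=
  Con.mk'_surjective

theorem finite_syntacticMonoid {α : Type*} {L : Language α} (hL : L.IsRegular) :
    Finite (SyntacticMonoid L) := by
  obtain ⟨σ, _, M, rfl⟩ := hL
  have hs := syntacticHom_surjective (M.accepts)
  choose g hg using hs
  refine Finite.of_injective
    (β := σ → σ) (fun t s => M.evalFrom s (FreeMonoid.toList (g t))) ?_
  intro t t' h
  rw [← hg t, ← hg t']
  refine (Con.eq _).2 ?_
  intro x y
  have h' := congrFun h (M.eval (FreeMonoid.toList x))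
  simp only [DFA.mem_accepts, DFA.eval, FreeMonoid.toList_mul, DFA.evalFrom_of_append] at h' ⊢
  rw [h']

/-! ### Periods -/

open Classical in
/-- `|w|_Γ`, the number of positions of `w` that carry a letter of `Γ`. -/
noncomputable def letterCount {α : Type*} (Γ : Set α) (w : FreeMonoid α) : ℕ :=
  (FreeMonoid.toList w).countP (fun a => decide (a ∈ Γ))

theorem letterCount_univ {α : Type*} (w : FreeMonoid α) :
    letterCount Set.univ w = w.length := by
  simp [letterCount, FreeMonoid.length]

/-- `L` has period `P` with respect to the non-empty set `Γ` of letters. -/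
def HasPeriod {α : Type*} (L : Language α) (Γ : Set α) (P : ℕ) : Prop :=
  Γ.Nonempty ∧ 0 < P ∧ ∀ w : FreeMonoid α,
    (∃ t : SyntacticMonoid L, t * syntacticHom L w = t) → P ∣ letterCount Γ w

/-- `P` is the maximum period of `L` with respect to `Γ`. -/
def IsMaxPeriod {α : Type*} (L : Language α) (Γ : Set α) (P : ℕ) : Prop :=
  IsGreatest {Q | HasPeriod L Γ Q} P

theorem IsMaxPeriod.hasPeriod {α : Type*} {L : Language α} {Γ : Set α} {P : ℕ}
    (h : IsMaxPeriod L Γ P) : HasPeriod L Γ P := h.1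

/-- The residual `ρ(w) = |w| mod P` of a word. -/
def wordResidual {α : Type*} (P : ℕ) : FreeMonoid α →* Multiplicative (ZMod P) where
  toFun w := Multiplicative.ofAdd (w.length : ZMod P)
  map_one' := by simp
  map_mul' u v := by simp

/-- Words with the same image in the syntactic monoid have the same residual. -/
theorem wordResidual_eq {α : Type*} {L : Language α} {P : ℕ} (hL : L.IsRegular)
    (hP : HasPeriod L Set.univ P) {u v : FreeMonoid α}
    (h : syntacticHom L u = syntacticHom L v) : wordResidual P u = wordResidual P v := by
  have := finite_syntacticMonoid hL
  have key : ∀ w : FreeMonoid α, (∃ t : SyntacticMonoid L, t * syntacticHom L w = t) →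
      wordResidual P w = 1 := by
    intro w hw
    have := hP.2.2 w hw
    rw [letterCount_univ] at this
    exact congrArg Multiplicative.ofAdd ((ZMod.natCast_eq_zero_iff _ _).2 this)
  obtain ⟨i, j, hij, he⟩ :=
    Finite.exists_ne_map_eq_of_infinite (fun n : ℕ => syntacticHom L u ^ n)
  wlog hlt : i < j generalizing i j with H
  · exact H j i hij.symm he.symm (lt_of_le_of_ne (not_lt.1 hlt) hij.symm)
  obtain ⟨k, rfl⟩ := Nat.exists_eq_add_of_lt hlt
  have e1 : wordResidual P (u ^ k * u) = 1 := key _ ⟨syntacticHom L u ^ i, by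
    rw [map_mul, map_pow, ← pow_succ, ← pow_add, ← add_assoc, ← he]⟩
  have e2 : wordResidual P (u ^ k * v) = 1 := key _ ⟨syntacticHom L u ^ i, by
    rw [map_mul, map_pow, ← h, ← pow_succ, ← pow_add, ← add_assoc, ← he]⟩
  rw [map_mul] at e1 e2
  exact mul_left_cancel (e1.trans e2.symm)

/-- The residual `ρ̄ : M_L → C_P`, characterised by `ρ̄(η_L(w)) = ρ(w)`. -/
noncomputable def residual {α : Type*} {L : Language α} {P : ℕ} (hL : L.IsRegular)
    (hP : HasPeriod L Set.univ P) : SyntacticMonoid L →* Multiplicative (ZMod P) :=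
  (syntacticCon L).lift (wordResidual P) fun _ _ h =>
    wordResidual_eq hL hP ((Con.eq _).2 h)

theorem residual_syntacticHom {α : Type*} {L : Language α} {P : ℕ} (hL : L.IsRegular)
    (hP : HasPeriod L Set.univ P) (w : FreeMonoid α) :
    residual hL hP (syntacticHom L w) = wordResidual P w := rfl

/-- `N_r = η_L({w | ρ(w) = r})`. -/
def residualClass {α : Type*} (L : Language α) (P : ℕ) (r : ZMod P) : Set (SyntacticMonoid L) :=
  syntacticHom L '' {w | (w.length : ZMod P) = r}

theorem mem_residualClass_iff {α : Type*} {L : Language α} {P : ℕ} (hL : L.IsRegular)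
    (hP : HasPeriod L Set.univ P) (r : ZMod P) (t : SyntacticMonoid L) :
    t ∈ residualClass L P r ↔ (residual hL hP t).toAdd = r := by
  obtain ⟨w, rfl⟩ := syntacticHom_surjective L t
  constructor
  · rintro ⟨v, hv, h⟩
    rw [← h]
    exact hv
  · intro h
    exact ⟨w, h, rfl⟩

theorem mul_mem_residualClass {α : Type*} {L : Language α} {P : ℕ} (hL : L.IsRegular)
    (hP : HasPeriod L Set.univ P) {r : ZMod P} {s : SyntacticMonoid L}
    (hs : s ∈ residualClass L P r) (t : SyntacticMonoid L) :
    s * t ∈ residualClass L P (r + (residual hL hP t).toAdd) := by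
  rw [mem_residualClass_iff hL hP] at hs ⊢
  rw [map_mul, toAdd_mul, hs]

/-- `K = max {|N_r| : r ∈ C_P}`. -/
noncomputable def maxClassCard {α : Type*} (L : Language α) (P : ℕ) : ℕ :=
  ⨆ r : ZMod P, Nat.card (residualClass L P r)

theorem card_residualClass_le {α : Type*} {L : Language α} (hL : L.IsRegular) (P : ℕ)
    (r : ZMod P) : Nat.card (residualClass L P r) ≤ maxClassCard L P := by
  have := finite_syntacticMonoid hL
  refine le_ciSup (f := fun r : ZMod P => Nat.card (residualClass L P r)) ?_ r
  refine ⟨Nat.card (SyntacticMonoid L), ?_⟩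
  rintro _ ⟨q, rfl⟩
  exact Nat.card_le_card_of_injective _ Subtype.val_injective

/-! ### Canonical homomorphism and residual monoids -/

/-- The monoid `T_K` of transformations of `{0, …, K-1}`, acting on the right: the product `σ · τ`
is "first `σ`, then `τ`", that is `τ ∘ σ`. -/
abbrev Transformations (K : ℕ) : Type := (Function.End (Fin K))ᵐᵒᵖ

/-- A choice of bijections `θ_r : {0, …, |N_r|-1} → N_r`. -/
abbrev Enumeration {α : Type*} (L : Language α) (P : ℕ) : Type _ :=
  ∀ r : ZMod P, Fin (Nat.card (residualClass L P r)) ≃ residualClass L P r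

/-- `f_t(r) ∈ T_K`: it sends `k < |N_r|` to `θ_{r + ρ̄(t)}⁻¹ (θ_r(k) · t)` and fixes every
`k ≥ |N_r|`. -/
noncomputable def canFun {α : Type*} {L : Language α} {P : ℕ} (hL : L.IsRegular)
    (hP : HasPeriod L Set.univ P) (θ : Enumeration L P) (t : SyntacticMonoid L) (r : ZMod P) :
    Transformations (maxClassCard L P) :=
  MulOpposite.op fun k =>
    if h : (k : ℕ) < Nat.card (residualClass L P r) then
      Fin.castLE (card_residualClass_le hL P (r + (residual hL hP t).toAdd))
        ((θ (r + (residual hL hP t).toAdd)).symm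
          ⟨(θ r ⟨k, h⟩ : SyntacticMonoid L) * t, mul_mem_residualClass hL hP (θ r ⟨k, h⟩).2 t⟩)
    else k

/-- The canonical map `Can(t) = (f_t, ρ̄(t))` into (the underlying set of) `T_K^{C_P} ⋊ C_P`. -/
noncomputable def can {α : Type*} {L : Language α} {P : ℕ} (hL : L.IsRegular)
    (hP : HasPeriod L Set.univ P) (θ : Enumeration L P) (t : SyntacticMonoid L) :
    (ZMod P → Transformations (maxClassCard L P)) × ZMod P :=
  (canFun hL hP θ t, (residual hL hP t).toAdd)

theorem canFun_apply {α : Type*} {L : Language α} {P : ℕ} (hL : L.IsRegular)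
    (hP : HasPeriod L Set.univ P) (θ : Enumeration L P) (t : SyntacticMonoid L) (r q : ZMod P)
    (hq : q = r + (residual hL hP t).toAdd) (k : Fin (maxClassCard L P))
    (h : (k : ℕ) < Nat.card (residualClass L P r))
    (m : (θ r ⟨k, h⟩ : SyntacticMonoid L) * t ∈ residualClass L P q) :
    (canFun hL hP θ t r).unop k =
      Fin.castLE (card_residualClass_le hL P q) ((θ q).symm ⟨_, m⟩) := by
  subst hq
  exact dif_pos h

theorem canFun_apply_of_le {α : Type*} {L : Language α} {P : ℕ} (hL : L.IsRegular)
    (hP : HasPeriod L Set.univ P) (θ : Enumeration L P) (t : SyntacticMonoid L) (r : ZMod P)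
    (k : Fin (maxClassCard L P)) (h : ¬ (k : ℕ) < Nat.card (residualClass L P r)) :
    (canFun hL hP θ t r).unop k = k :=
  dif_neg h

theorem canFun_one {α : Type*} {L : Language α} {P : ℕ} (hL : L.IsRegular)
    (hP : HasPeriod L Set.univ P) (θ : Enumeration L P) (r : ZMod P) :
    canFun hL hP θ 1 r = 1 := by
  apply MulOpposite.unop_injective
  funext k
  change (canFun hL hP θ 1 r).unop k = k
  by_cases h : (k : ℕ) < Nat.card (residualClass L P r)
  · have e : (θ r ⟨k, h⟩ : SyntacticMonoid L) * 1 = θ r ⟨k, h⟩ := mul_one _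
    have m : (θ r ⟨k, h⟩ : SyntacticMonoid L) * 1 ∈ residualClass L P r := by
      rw [e]; exact (θ r ⟨k, h⟩).2
    rw [canFun_apply hL hP θ 1 r r (by simp) k h m, (Subtype.ext e : (⟨_, m⟩ :
      residualClass L P r) = θ r ⟨k, h⟩), Equiv.symm_apply_apply]
    rfl
  · exact canFun_apply_of_le hL hP θ 1 r k h

/-- For `ρ̄(s) = ρ̄(t) = 0` one has `f_{st}(r) = f_s(r) · f_t(r)`. -/
theorem canFun_mul {α : Type*} {L : Language α} {P : ℕ} (hL : L.IsRegular)
    (hP : HasPeriod L Set.univ P) (θ : Enumeration L P) (s t : SyntacticMonoid L) (r : ZMod P)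
    (hs : (residual hL hP s).toAdd = 0) (ht : (residual hL hP t).toAdd = 0) :
    canFun hL hP θ (s * t) r = canFun hL hP θ s r * canFun hL hP θ t r := by
  apply MulOpposite.unop_injective
  funext k
  change (canFun hL hP θ (s * t) r).unop k =
    (canFun hL hP θ t r).unop ((canFun hL hP θ s r).unop k)
  have hst : (residual hL hP (s * t)).toAdd = 0 := by rw [map_mul, toAdd_mul, hs, ht, add_zero]
  have mem : ∀ {u v : SyntacticMonoid L}, u ∈ residualClass L P r →
      (residual hL hP v).toAdd = 0 → u * v ∈ residualClass L P r := by
    intro u v hu hv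
    have := mul_mem_residualClass hL hP hu v
    rwa [hv, add_zero] at this
  by_cases h : (k : ℕ) < Nat.card (residualClass L P r)
  · have m1 := mem (θ r ⟨k, h⟩).2 hs
    have m2 := mem (θ r ⟨k, h⟩).2 hst
    rw [canFun_apply hL hP θ s r r (by rw [hs, add_zero]) k h m1,
      canFun_apply hL hP θ (s * t) r r (by rw [hst, add_zero]) k h m2]
    set j := (θ r).symm ⟨_, m1⟩ with hj
    have hj' : θ r j = ⟨_, m1⟩ := by rw [hj, Equiv.apply_symm_apply]
    have m3 := mem (θ r j).2 ht
    rw [canFun_apply hL hP θ t r r (by rw [ht, add_zero])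
      (Fin.castLE (card_residualClass_le hL P r) j) j.2 m3]
    congr 2
    apply Subtype.ext
    change (θ r ⟨k, h⟩ : SyntacticMonoid L) * (s * t) = (θ r j : SyntacticMonoid L) * t
    rw [hj', mul_assoc]
  · rw [canFun_apply_of_le hL hP θ (s * t) r k h, canFun_apply_of_le hL hP θ s r k h,
      canFun_apply_of_le hL hP θ t r k h]

/-- The residual monoid `T_r = {τ ∈ T_K : τ = f(r) for some (f, 0) ∈ Can(M_L)}`. -/
def residualMonoid {α : Type*} {L : Language α} {P : ℕ} (hL : L.IsRegular)
    (hP : HasPeriod L Set.univ P) (θ : Enumeration L P) (r : ZMod P) :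
    Submonoid (Transformations (maxClassCard L P)) where
  carrier := {τ | ∃ f : ZMod P → Transformations (maxClassCard L P),
    (f, 0) ∈ Set.range (can hL hP θ) ∧ τ = f r}
  one_mem' := ⟨_, ⟨1, Prod.ext rfl (by simp [can])⟩, (canFun_one hL hP θ r).symm⟩
  mul_mem' := by
    rintro _ _ ⟨f, ⟨s, hs⟩, rfl⟩ ⟨g, ⟨t, ht⟩, rfl⟩
    obtain ⟨rfl, hs0⟩ := Prod.ext_iff.1 hs
    obtain ⟨rfl, ht0⟩ := Prod.ext_iff.1 ht
    refine ⟨_, ⟨s * t, Prod.ext rfl ?_⟩, (canFun_mul hL hP θ s t r hs0 ht0).symm⟩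
    simp only [can] at hs0 ht0 ⊢
    rw [map_mul, toAdd_mul, hs0, ht0, add_zero]

/-! ### The languages `L_w` over the alphabet `Σ^P` -/

/-- The canonical embedding `(Σ^P)^* → Σ^*` that concatenates the blocks. -/
def expand (α : Type*) (P : ℕ) : FreeMonoid (Fin P → α) →* FreeMonoid α :=
  FreeMonoid.lift fun v => FreeMonoid.ofList (List.ofFn v)

theorem length_expand {α : Type*} {P : ℕ} (u : FreeMonoid (Fin P → α)) :
    (expand α P u).length = P * u.length := by
  induction u using FreeMonoid.inductionOn' with
  | one => simp
  | of_mul v u ih =>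
    have : (expand α P (FreeMonoid.of v)).length = P := by
      simp [expand, FreeMonoid.length]
    rw [map_mul, FreeMonoid.length_mul, FreeMonoid.length_mul, ih, this, FreeMonoid.length_of]
    ring

/-- `L_w = {u ∈ (Σ^P)^* : wu ∈ L}`, a language over the alphabet `Σ^P`. -/
def blockQuotient {α : Type*} (L : Language α) (P : ℕ) (w : List α) : Language (Fin P → α) :=
  {u : List (Fin P → α) | w ++ FreeMonoid.toList (expand α P (FreeMonoid.ofList u)) ∈ L}

theorem residual_expand {α : Type*} {L : Language α} {P : ℕ} (hL : L.IsRegular)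
    (hP : HasPeriod L Set.univ P) (u : FreeMonoid (Fin P → α)) :
    (residual hL hP (syntacticHom L (expand α P u))).toAdd = 0 := by
  rw [residual_syntacticHom]
  change ((expand α P u).length : ZMod P) = 0
  rw [length_expand]
  simp

/-- The homomorphism `(Σ^P)^* → T_r`, `u ↦ f(r)` where `Can(η_L(u)) = (f, 0)`. For a word `w` with
`|w| = r < P` this is `η_w`. -/
noncomputable def blockHom {α : Type*} {L : Language α} {P : ℕ} (hL : L.IsRegular)
    (hP : HasPeriod L Set.univ P) (θ : Enumeration L P) (r : ZMod P) :
    FreeMonoid (Fin P → α) →* residualMonoid hL hP θ r where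
  toFun u := ⟨(can hL hP θ (syntacticHom L (expand α P u))).1 r, _,
    ⟨_, Prod.ext rfl (residual_expand hL hP u)⟩, rfl⟩
  map_one' := Subtype.ext (by
    change canFun hL hP θ (syntacticHom L (expand α P 1)) r = 1
    rw [map_one, map_one]
    exact canFun_one hL hP θ r)
  map_mul' u v := Subtype.ext (by
    change canFun hL hP θ (syntacticHom L (expand α P (u * v))) r =
      canFun hL hP θ (syntacticHom L (expand α P u)) r *
        canFun hL hP θ (syntacticHom L (expand α P v)) r
    rw [map_mul, map_mul]
    exact canFun_mul hL hP θ _ _ r (residual_expand hL hP u) (residual_expand hL hP v))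

/-- The image of `L_w` under `blockHom`; for `|w| = r` this is `η_w(L_w)`. -/
def blockImage {α : Type*} {L : Language α} {P : ℕ} (hL : L.IsRegular)
    (hP : HasPeriod L Set.univ P) (θ : Enumeration L P) (r : ZMod P) (w : List α) :
    Set (residualMonoid hL hP θ r) :=
  {τ | ∃ u ∈ blockQuotient L P w, blockHom hL hP θ r (FreeMonoid.ofList u) = τ}

/-! ### Densities and ideals -/

/-- The density `μ_L(ℓ) = |L ∩ Σ^ℓ| / |Σ^ℓ|`. -/
noncomputable def density {α : Type*} (L : Language α) (n : ℕ) : ℝ :=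
  ({u : List α | u ∈ L ∧ u.length = n}.ncard : ℝ) / ({u : List α | u.length = n}.ncard : ℝ)

open scoped Pointwise in
/-- A (two-sided) ideal of a monoid `M`: a subset `I` with `I M = I = M I`. -/
def IsMonoidIdeal {M : Type*} [Monoid M] (I : Set M) : Prop :=
  I * Set.univ = I ∧ Set.univ * I = I

end PeriodicLanguage

open PeriodicLanguage

/-! Reading a uniformly random word over the block alphabet `Fin P → α` is a random walk on the
finite monoid `T_r`. As `L_w` is the full preimage of its image in `T_r`
(`blockQuotient_eq_preimage`), its density at length `n` is the probability that the walk from `1`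
lies in that image after `n` steps (`density_preimage_eq`).

The walk enters every non-empty ideal with probability tending to `1`
(`tendsto_avgOp_pow_compl_ideal`), which gives (ii) → (i). For (i) → (ii) the ideal is
`recurrentSet`: each of its elements is occupied with probability bounded below at all large times
(`exists_pos_le_avgOp_pow`), so density `0` or `1` leaves no recurrent element inside, respectively
outside, the image.

This bound and the existence of the limit rest on aperiodicity, expressed by `ReachesIn`: one length
`N` serves all recurrent elements. Here the maximality of `P` enters: a common divisor `d` of the
loop lengths at a recurrent element makes `P * d` a period (`hasPeriod_mul_of_dvd`), so these
lengths have gcd `1` and contain all large integers. -/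

namespace PeriodicLanguage

/-! ### Recurrent elements of a finite monoid -/

section Recurrent

variable {M : Type*} [Monoid M]

/-- The elements `s` that can be reached back from each of their right multiples; in a finite
monoid they form the minimal ideal. -/
def recurrentSet (M : Type*) [Monoid M] : Set M := {s | ∀ t, ∃ z, s * t * z = s}

theorem mul_mem_recurrentSet {s : M} (hs : s ∈ recurrentSet M) (t : M) :
    s * t ∈ recurrentSet M := by
  intro t'
  obtain ⟨z, hz⟩ := hs (t * t')
  exact ⟨z * t, by rw [← mul_assoc, mul_assoc s t t', hz]⟩

theorem mul_mem_recurrentSet_left {s : M} (hs : s ∈ recurrentSet M) (t : M) :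
    t * s ∈ recurrentSet M := by
  intro t'
  obtain ⟨z, hz⟩ := hs t'
  exact ⟨z, by rw [mul_assoc t, mul_assoc t, hz]⟩

/-- An `s` whose right ideal `sM` has least cardinality works, since `stM ⊆ sM` is then an equality.
-/
theorem recurrentSet_nonempty [Finite M] : (recurrentSet M).Nonempty := by
  obtain ⟨s, hs⟩ := Finite.exists_min (fun s : M => (Set.range (s * ·)).ncard)
  refine ⟨s, fun t => ?_⟩
  have hsub : Set.range (s * t * ·) ⊆ Set.range (s * ·) := by
    rintro _ ⟨x, rfl⟩
    exact ⟨t * x, (mul_assoc s t x).symm⟩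
  have heq := Set.eq_of_subset_of_ncard_le hsub (hs (s * t)) (Set.toFinite _)
  have : s ∈ Set.range (s * ·) := ⟨1, mul_one s⟩
  rw [← heq] at this
  exact this

open scoped Pointwise in
theorem isMonoidIdeal_iff {I : Set M} :
    IsMonoidIdeal I ↔ ∀ s ∈ I, ∀ t, s * t ∈ I ∧ t * s ∈ I := by
  constructor
  · rintro ⟨h1, h2⟩ s hs t
    exact ⟨h1 ▸ Set.mul_mem_mul hs (Set.mem_univ t), h2 ▸ Set.mul_mem_mul (Set.mem_univ t) hs⟩
  · intro h
    refine ⟨Set.Subset.antisymm ?_ ?_, Set.Subset.antisymm ?_ ?_⟩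
    · rintro _ ⟨s, hs, t, -, rfl⟩
      exact (h s hs t).1
    · exact fun s hs => ⟨s, hs, 1, Set.mem_univ _, mul_one s⟩
    · rintro _ ⟨t, -, s, hs, rfl⟩
      exact (h s hs t).2
    · exact fun s hs => ⟨1, Set.mem_univ _, s, hs, one_mul s⟩

theorem isMonoidIdeal_recurrentSet : IsMonoidIdeal (recurrentSet M) :=
  isMonoidIdeal_iff.2 fun _ hs t => ⟨mul_mem_recurrentSet hs t, mul_mem_recurrentSet_left hs t⟩

end Recurrent

theorem indicator_one_nonneg {M : Type*} (E : Set M) (s : M) : (0 : ℝ) ≤ E.indicator 1 s :=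
  Set.indicator_nonneg (fun _ _ => zero_le_one) s

theorem indicator_one_le_one {M : Type*} (E : Set M) (s : M) : E.indicator 1 s ≤ (1 : ℝ) :=
  Set.indicator_le_self' (fun _ _ => zero_le_one) s

/-! ### The averaging operator of a random walk on a monoid -/

section Walk

variable {A M : Type*} [Fintype A] [Monoid M] (φ : FreeMonoid A →* M)

/-- The transition operator of the random walk on `M` that multiplies on the right by the image
of a uniformly random letter. -/
noncomputable def avgOp : (M → ℝ) →ₗ[ℝ] (M → ℝ) where
  toFun f s := (Fintype.card A : ℝ)⁻¹ * ∑ a, f (s * φ (FreeMonoid.of a))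
  map_add' f g := by
    ext s
    simp [Finset.sum_add_distrib, mul_add]
  map_smul' r f := by
    ext s
    simp only [Pi.smul_apply, smul_eq_mul, RingHom.id_apply, ← Finset.mul_sum]
    ring

theorem avgOp_pow_succ_apply (n : ℕ) (f : M → ℝ) (s : M) :
    (avgOp φ ^ (n + 1)) f s =
      (Fintype.card A : ℝ)⁻¹ * ∑ a, (avgOp φ ^ n) f (s * φ (FreeMonoid.of a)) := by
  rw [pow_succ']
  rfl

theorem avgOp_pow_mono (n : ℕ) {f g : M → ℝ} {s : M} (h : ∀ t, f (s * t) ≤ g (s * t)) :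
    (avgOp φ ^ n) f s ≤ (avgOp φ ^ n) g s := by
  induction n generalizing s with
  | zero => simpa using h 1
  | succ n ih =>
    rw [avgOp_pow_succ_apply, avgOp_pow_succ_apply]
    gcongr with a
    refine ih fun t => ?_
    rw [mul_assoc]
    exact h _

theorem avgOp_pow_const [Nonempty A] (n : ℕ) (r : ℝ) (s : M) :
    (avgOp φ ^ n) (fun _ => r) s = r := by
  induction n generalizing s with
  | zero => simp
  | succ n ih =>
    rw [avgOp_pow_succ_apply]
    simp [ih]

theorem avgOp_pow_le [Nonempty A] (n : ℕ) {f : M → ℝ} {s : M} {r : ℝ}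
    (h : ∀ t, f (s * t) ≤ r) : (avgOp φ ^ n) f s ≤ r :=
  (avgOp_pow_mono φ n h).trans_eq (avgOp_pow_const φ n r s)

theorem le_avgOp_pow [Nonempty A] (n : ℕ) {f : M → ℝ} {s : M} {r : ℝ}
    (h : ∀ t, r ≤ f (s * t)) : r ≤ (avgOp φ ^ n) f s :=
  (avgOp_pow_const φ n r s).symm.trans_le (avgOp_pow_mono φ n h)

/-- Keep only the contribution of the single word `u`, which is read with probability `|A|⁻¹ ^ |u|`.
All lower bounds below come from this. -/
theorem pow_mul_le_avgOp_pow [Nonempty A] {f : M → ℝ} {s : M} (h : ∀ t, 0 ≤ f (s * t))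
    (u : FreeMonoid A) :
    (Fintype.card A : ℝ)⁻¹ ^ u.length * f (s * φ u) ≤ (avgOp φ ^ u.length) f s := by
  induction u using FreeMonoid.inductionOn' generalizing s with
  | one => simp
  | of_mul a u ih =>
    have h' : ∀ b t, 0 ≤ f (s * φ (FreeMonoid.of b) * t) := fun b t => by
      rw [mul_assoc]
      exact h _
    rw [FreeMonoid.length_mul, FreeMonoid.length_of, add_comm 1, avgOp_pow_succ_apply, pow_succ',
      mul_assoc, map_mul, ← mul_assoc s]
    gcongr
    exact (ih (h' a)).trans (Finset.single_le_sum
      (f := fun b => (avgOp φ ^ u.length) f (s * φ (FreeMonoid.of b)))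
      (fun b _ => le_avgOp_pow φ _ (h' b)) (Finset.mem_univ a))

theorem inv_card_pow_pos [Nonempty A] (n : ℕ) : 0 < (Fintype.card A : ℝ)⁻¹ ^ n := by
  have : (0 : ℝ) < Fintype.card A := by exact_mod_cast Fintype.card_pos
  positivity

theorem inv_card_pow_le_one [Nonempty A] (n : ℕ) : (Fintype.card A : ℝ)⁻¹ ^ n ≤ 1 := by
  have : (1 : ℝ) ≤ Fintype.card A := by exact_mod_cast Fintype.card_pos
  exact pow_le_one₀ (by positivity) (inv_le_one_of_one_le₀ this)

theorem ncard_walk_eq [Nonempty A] (n : ℕ) (s : M) (E : Set M) :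
    ({u : List A | s * φ (FreeMonoid.ofList u) ∈ E ∧ u.length = n}.ncard : ℝ) =
      (Fintype.card A : ℝ) ^ n * (avgOp φ ^ n) (E.indicator 1) s := by
  have hA : (Fintype.card A : ℝ) ≠ 0 := by exact_mod_cast Fintype.card_ne_zero
  induction n generalizing s with
  | zero =>
    by_cases h : s ∈ E
    · have : {u : List A | s * φ (FreeMonoid.ofList u) ∈ E ∧ u.length = 0} = {[]} := by
        ext u
        refine ⟨fun hu => List.length_eq_zero_iff.1 hu.2, ?_⟩
        rintro rfl
        exact ⟨by simpa using h, rfl⟩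
      rw [this]
      simp [h]
    · have : {u : List A | s * φ (FreeMonoid.ofList u) ∈ E ∧ u.length = 0} = ∅ := by
        refine Set.eq_empty_of_forall_notMem fun u hu => h ?_
        obtain rfl := List.length_eq_zero_iff.1 hu.2
        simpa using hu.1
      rw [this]
      simp [h]
  | succ n ih =>
    let S : ℕ → M → Set (List A) := fun n s =>
      {u | s * φ (FreeMonoid.ofList u) ∈ E ∧ u.length = n}
    let e : S (n + 1) s ≃ Σ a : A, S n (s * φ (FreeMonoid.of a)) :=
      { toFun := fun u => match u with
          | ⟨a :: u, hu⟩ => ⟨a, u, by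
              have := hu.1
              rwa [FreeMonoid.ofList_cons, map_mul, ← mul_assoc] at this,
              Nat.succ_injective hu.2⟩
        invFun := fun x => ⟨x.1 :: x.2.1, by
              rw [FreeMonoid.ofList_cons, map_mul, ← mul_assoc]
              exact x.2.2.1,
              congrArg Nat.succ x.2.2.2⟩
        left_inv := by
          rintro ⟨_ | ⟨a, u⟩, hu⟩
          · exact absurd hu.2 (by simp)
          · rfl
        right_inv := fun _ => rfl }
    have hfin : ∀ a : A, Finite (S n (s * φ (FreeMonoid.of a))) :=
      fun a => ((List.finite_length_eq A n).subset fun u hu => hu.2).to_subtype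
    have hcard : (S (n + 1) s).ncard = ∑ a, (S n (s * φ (FreeMonoid.of a))).ncard := by
      rw [← Nat.card_coe_set_eq, Nat.card_congr e, Nat.card_sigma]
      simp only [Nat.card_coe_set_eq]
    change ((S (n + 1) s).ncard : ℝ) = _
    rw [hcard, avgOp_pow_succ_apply, Nat.cast_sum, Finset.sum_congr rfl fun a _ => ih _,
      ← Finset.mul_sum, pow_succ]
    field_simp

theorem density_preimage_eq [Nonempty A] (n : ℕ) (E : Set M) :
    density {u : List A | φ (FreeMonoid.ofList u) ∈ E} n = (avgOp φ ^ n) (E.indicator 1) 1 := by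
  have hA : (Fintype.card A : ℝ) ≠ 0 := by exact_mod_cast Fintype.card_ne_zero
  have h1 := ncard_walk_eq φ n 1 E
  have h2 := ncard_walk_eq φ n 1 Set.univ
  simp only [one_mul, Set.mem_univ, true_and, Set.indicator_univ] at h1 h2
  have h3 : (avgOp φ ^ n) 1 1 = 1 := avgOp_pow_const φ n 1 1
  rw [h3, mul_one] at h2
  unfold density
  rw [h2, div_eq_iff (pow_ne_zero _ hA), mul_comm]
  exact h1

theorem avgOp_pow_indicator_compl [Nonempty A] (n : ℕ) (E : Set M) (s : M) :
    (avgOp φ ^ n) (Eᶜ.indicator 1) s = 1 - (avgOp φ ^ n) (E.indicator 1) s := by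
  have h : (Eᶜ.indicator 1 : M → ℝ) = (fun _ => 1) - E.indicator 1 := by
    rw [Set.indicator_compl]
    rfl
  rw [h, map_sub, Pi.sub_apply, avgOp_pow_const]

variable {φ}

/-- The walk eventually enters every ideal, uniformly in the starting point. -/
theorem tendsto_avgOp_pow_compl_ideal [Nonempty A] (hφ : Function.Surjective φ) {I : Set M}
    (hI : I.Nonempty) (hideal : IsMonoidIdeal I) {ε : ℝ} (hε : 0 < ε) :
    ∃ m₀, ∀ m ≥ m₀, ∀ s, (avgOp φ ^ m) (Iᶜ.indicator 1) s < ε := by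
  rw [isMonoidIdeal_iff] at hideal
  obtain ⟨i, hi⟩ := hI
  -- Reading `v` sends every element into `I`, so each round of `l` letters leaves the walk outside
  -- `I` with conditional probability at most `k`.
  obtain ⟨v, rfl⟩ := hφ i
  set l := v.length with hl
  set k : ℝ := 1 - (Fintype.card A : ℝ)⁻¹ ^ l with hk
  have hk0 : 0 ≤ k := sub_nonneg.2 (inv_card_pow_le_one l)
  have hk1 : k < 1 := sub_lt_self _ (inv_card_pow_pos l)
  set g : M → ℝ := Iᶜ.indicator 1 with hg
  have step : ∀ s, (avgOp φ ^ l) g s ≤ k * g s := by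
    intro s
    by_cases hs : s ∈ I
    · have : g s = 0 := Set.indicator_of_notMem (Set.notMem_compl_iff.2 hs) _
      rw [this, mul_zero]
      exact avgOp_pow_le φ l fun t =>
        (Set.indicator_of_notMem (Set.notMem_compl_iff.2 (hideal s hs t).1) _).le
    · have : g s = 1 := Set.indicator_of_mem hs _
      rw [this, mul_one, hg, avgOp_pow_indicator_compl, hk]
      have := pow_mul_le_avgOp_pow φ (f := I.indicator 1) (s := s)
        (fun t => indicator_one_nonneg _ _) v
      rw [Set.indicator_of_mem (hideal _ hi s).2, Pi.one_apply, mul_one] at this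
      linarith
  have geom : ∀ j s, (avgOp φ ^ (l * j)) g s ≤ k ^ j := by
    intro j
    induction j with
    | zero => exact fun s => by simpa using indicator_one_le_one _ s
    | succ j ih =>
      intro s
      rw [mul_add_one, pow_add]
      calc (avgOp φ ^ (l * j)) ((avgOp φ ^ l) g) s
          ≤ (avgOp φ ^ (l * j)) (k • g) s := avgOp_pow_mono φ _ fun t => step _
        _ = k * (avgOp φ ^ (l * j)) g s := by rw [map_smul]; rfl
        _ ≤ k ^ (j + 1) := by
          rw [pow_succ']
          exact mul_le_mul_of_nonneg_left (ih s) hk0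
  obtain ⟨j, hj⟩ := exists_pow_lt_of_lt_one hε hk1
  refine ⟨l * j, fun m hm s => ?_⟩
  obtain ⟨n, rfl⟩ := Nat.exists_eq_add_of_le' hm
  rw [pow_add]
  exact (avgOp_pow_le φ n fun t => geom j _).trans_lt hj

/-- From every recurrent element, all of its right multiples are reached by words of length `N`. -/
def ReachesIn (φ : FreeMonoid A →* M) (N : ℕ) : Prop :=
  ∀ s ∈ recurrentSet M, ∀ t, ∃ u : FreeMonoid A, u.length = N ∧ s * φ u = s * t

/-- Doeblin contraction: from each starting point in `sM` some word of length `N` leads to the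
minimum of `h` on `sM`, so averaging pulls every value off the maximum by a fixed proportion of `K`.
-/
theorem avgOp_pow_osc_le [Finite M] [Nonempty A] {N : ℕ} (hN : ReachesIn φ N) {h : M → ℝ} {K : ℝ}
    (hK : ∀ s ∈ recurrentSet M, ∀ t, h s - h (s * t) ≤ K) {s : M} (hs : s ∈ recurrentSet M)
    (t : M) : (avgOp φ ^ N) h s - (avgOp φ ^ N) h (s * t) ≤
      (1 - (Fintype.card A : ℝ)⁻¹ ^ N) * K := by
  obtain ⟨t₁, ht₁⟩ := Finite.exists_min fun t => h (s * t)
  -- The minimiser is also a right multiple of `s * t'`, by way of `s`, so `hK` applies between the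
  -- two.
  have hup : ∀ t, h (s * t) ≤ h (s * t₁) + K := by
    intro t'
    obtain ⟨z, hz⟩ := hs t'
    have := hK (s * t') (mul_mem_recurrentSet hs t') (z * t₁)
    rw [← mul_assoc, hz] at this
    linarith
  have h1 : h (s * t₁) ≤ (avgOp φ ^ N) h (s * t) :=
    le_avgOp_pow φ N fun t' => by rw [mul_assoc]; exact ht₁ _
  obtain ⟨u, hu, hut⟩ := hN s hs t₁
  have h2 := pow_mul_le_avgOp_pow φ (f := (fun _ => h (s * t₁) + K) - h) (s := s)
    (fun t => sub_nonneg.2 (hup t)) u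
  rw [hu, hut, map_sub, Pi.sub_apply, Pi.sub_apply, avgOp_pow_const] at h2
  linarith

theorem exists_avgOp_pow_osc_lt [Finite M] [Nonempty A] {N : ℕ} (hN : ReachesIn φ N) (E : Set M)
    {ε : ℝ} (hε : 0 < ε) :
    ∃ n, ∀ s ∈ recurrentSet M, ∀ t,
      |(avgOp φ ^ n) (E.indicator 1) (s * t) - (avgOp φ ^ n) (E.indicator 1) s| < ε := by
  set k : ℝ := 1 - (Fintype.card A : ℝ)⁻¹ ^ N with hk
  have hk1 : k < 1 := sub_lt_self _ (inv_card_pow_pos N)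
  have geom : ∀ j, ∀ s ∈ recurrentSet M, ∀ t, (avgOp φ ^ (N * j)) (E.indicator 1) s -
      (avgOp φ ^ (N * j)) (E.indicator 1) (s * t) ≤ k ^ j := by
    intro j
    induction j with
    | zero =>
      intro s _ t
      have h1 := indicator_one_le_one E s
      have h2 := indicator_one_nonneg E (s * t)
      simp only [mul_zero, pow_zero, Module.End.one_apply]
      linarith
    | succ j ih =>
      intro s hs t
      rw [mul_add_one, add_comm, pow_add, pow_succ']
      exact avgOp_pow_osc_le hN ih hs t
  obtain ⟨j, hj⟩ := exists_pow_lt_of_lt_one hε hk1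
  refine ⟨N * j, fun s hs t => abs_sub_lt_iff.2 ⟨?_, (geom j s hs t).trans_lt hj⟩⟩
  -- The opposite inequality is `geom` based at `s * t`, from which `s` is reached back.
  obtain ⟨z, hz⟩ := hs t
  have := geom j (s * t) (mul_mem_recurrentSet hs t) z
  rw [hz] at this
  exact this.trans_lt hj

/-- Cauchy criterion: the first `m` letters bring the walk into `recurrentSet M` up to probability
`ε / 2`, and from there `n` or more further letters give values that agree within `ε / 2`. -/
theorem exists_tendsto_avgOp_pow [Finite M] [Nonempty A] (hφ : Function.Surjective φ) {N : ℕ}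
    (hN : ReachesIn φ N) (E : Set M) (s : M) :
    ∃ μ, Tendsto (fun n => (avgOp φ ^ n) (E.indicator 1) s) atTop (𝓝 μ) := by
  refine cauchySeq_tendsto_of_complete (Metric.cauchySeq_iff'.2 fun ε hε => ?_)
  obtain ⟨n, hn⟩ := exists_avgOp_pow_osc_lt hN E (half_pos hε)
  obtain ⟨m, hm⟩ := tendsto_avgOp_pow_compl_ideal hφ recurrentSet_nonempty
    isMonoidIdeal_recurrentSet (half_pos hε)
  specialize hm m le_rfl s
  set f : ℕ → M → ℝ := fun n => (avgOp φ ^ n) (E.indicator 1) with hf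
  have hadd : ∀ i j, f (i + j) = (avgOp φ ^ i) (f j) := fun i j => by
    simp only [hf, pow_add, Module.End.mul_apply]
  have h0 : ∀ j t, 0 ≤ f j t := fun j t => le_avgOp_pow φ j fun _ => indicator_one_nonneg _ _
  have h1 : ∀ j t, f j t ≤ 1 := fun j t => avgOp_pow_le φ j fun _ => indicator_one_le_one _ _
  set g : M → ℝ := (recurrentSet M)ᶜ.indicator 1 with hg
  have hrec : ∀ k t, |f (k + n) t - f n t| ≤ ε / 2 + g t := by
    intro k t
    by_cases ht : t ∈ recurrentSet M
    · have hgt : g t = 0 := Set.indicator_of_notMem (Set.notMem_compl_iff.2 ht) _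
      rw [hgt, add_zero, hadd, abs_sub_le_iff]
      have hb := fun x => abs_sub_lt_iff.1 (hn t ht x)
      constructor
      · have := avgOp_pow_le φ k (f := f n) (s := t) (r := f n t + ε / 2)
          fun x => by linarith [(hb x).1]
        linarith
      · have := le_avgOp_pow φ k (f := f n) (s := t) (r := f n t - ε / 2)
          fun x => by linarith [(hb x).2]
        linarith
    · have hgt : g t = 1 := Set.indicator_of_mem ht _
      rw [hgt, abs_sub_le_iff]
      constructor <;> linarith [h0 n t, h1 n t, h0 (k + n) t, h1 (k + n) t]
  have hbound : (avgOp φ ^ m) ((fun _ => ε / 2) + g) s < ε := by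
    rw [map_add, Pi.add_apply, avgOp_pow_const]
    linarith
  refine ⟨m + n, fun i hi => ?_⟩
  obtain ⟨k, rfl⟩ := Nat.exists_eq_add_of_le hi
  change |f (m + n + k) s - f (m + n) s| < ε
  rw [add_assoc, add_comm n, hadd m, hadd m, ← Pi.sub_apply, ← map_sub]
  refine (abs_le.2 ⟨?_, ?_⟩).trans_lt hbound
  · rw [neg_le, ← Pi.neg_apply, ← map_neg]
    exact avgOp_pow_mono φ m fun t => by
      have := (abs_le.1 (hrec k (s * t))).1
      simp only [Pi.neg_apply, Pi.sub_apply, Pi.add_apply]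
      linarith
  · exact avgOp_pow_mono φ m fun t => (le_abs_self _).trans (hrec k _)

/-- A set that contains a recurrent element has positive limiting probability. -/
theorem exists_pos_le_avgOp_pow [Nonempty A] (hφ : Function.Surjective φ) {N : ℕ}
    (hN : ReachesIn φ N) {E : Set M} {t : M} (ht : t ∈ recurrentSet M) (htE : t ∈ E) :
    ∃ δ > 0, ∀ᶠ n in atTop, δ ≤ (avgOp φ ^ n) (E.indicator 1) 1 := by
  obtain ⟨v, rfl⟩ := hφ t
  have hnn : ∀ n t, 0 ≤ (avgOp φ ^ n) (E.indicator 1) t :=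
    fun n t => le_avgOp_pow φ n fun _ => indicator_one_nonneg _ _
  refine ⟨(Fintype.card A : ℝ)⁻¹ ^ v.length * (Fintype.card A : ℝ)⁻¹ ^ N,
    mul_pos (inv_card_pow_pos _) (inv_card_pow_pos _), ?_⟩
  filter_upwards [eventually_ge_atTop (v.length + N)] with i hi
  obtain ⟨n, rfl⟩ := Nat.exists_eq_add_of_le hi
  -- After `v`, the next `n` letters are arbitrary and lead to some `φ v * x`; the last `N` letters
  -- can return to `φ v`, with probability at least `|A|⁻¹ ^ N`.
  have h2 : (Fintype.card A : ℝ)⁻¹ ^ N ≤ (avgOp φ ^ (n + N)) (E.indicator 1) (φ v) := by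
    rw [pow_add]
    refine le_avgOp_pow φ n fun x => ?_
    obtain ⟨z, hz⟩ := ht x
    obtain ⟨u, rfl, hu⟩ := hN _ (mul_mem_recurrentSet ht x) z
    have := pow_mul_le_avgOp_pow φ (f := E.indicator 1) (s := φ v * x)
      (fun _ => indicator_one_nonneg _ _) u
    rwa [hu, hz, Set.indicator_of_mem htE, Pi.one_apply, mul_one] at this
  have h1 := pow_mul_le_avgOp_pow φ (f := (avgOp φ ^ (n + N)) (E.indicator 1)) (s := 1)
    (fun _ => hnn _ _) v
  rw [one_mul] at h1
  rw [add_assoc, add_comm N, pow_add]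
  exact (mul_le_mul_of_nonneg_left h2 (inv_card_pow_pos _).le).trans h1

theorem tendsto_density_zero_or_one_iff [Finite M] [Nonempty A] (hφ : Function.Surjective φ)
    {N : ℕ} (hN : ReachesIn φ N) (E : Set M) :
    ∃ μ : ℝ, Tendsto (density {u : List A | φ (FreeMonoid.ofList u) ∈ E}) atTop (𝓝 μ) ∧
      ((μ = 0 ∨ μ = 1) ↔
        ∃ I : Set M, I.Nonempty ∧ IsMonoidIdeal I ∧ (I ∩ E = ∅ ∨ I ⊆ E)) := by
  obtain ⟨μ, hμ⟩ := exists_tendsto_avgOp_pow hφ hN E 1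
  have hμc : Tendsto (fun n => (avgOp φ ^ n) (Eᶜ.indicator 1) 1) atTop (𝓝 (1 - μ)) := by
    simp only [avgOp_pow_indicator_compl]
    exact hμ.const_sub 1
  refine ⟨μ, hμ.congr fun n => (density_preimage_eq φ n E).symm, ?_, ?_⟩
  -- Stated for a general `F` so that `E` covers density `0` and `Eᶜ` density `1`.
  · have pos : ∀ {F : Set M} {ν : ℝ},
        Tendsto (fun n => (avgOp φ ^ n) (F.indicator 1) 1) atTop (𝓝 ν) → ν = 0 →
        recurrentSet M ⊆ Fᶜ := by
      rintro F ν hν h0 t ht htF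
      obtain ⟨δ, hδ, hev⟩ := exists_pos_le_avgOp_pow hφ hN ht htF
      exact absurd (ge_of_tendsto hν hev) (by rw [h0]; exact not_le.2 hδ)
    intro h
    refine ⟨recurrentSet M, recurrentSet_nonempty, isMonoidIdeal_recurrentSet, h.imp ?_ ?_⟩
    · exact fun h => Set.disjoint_iff_inter_eq_empty.1
        (Set.subset_compl_iff_disjoint_right.1 (pos hμ h))
    · intro h
      have := pos hμc (sub_eq_zero.2 h.symm)
      rwa [compl_compl] at this
  · rintro ⟨I, hI, hideal, h⟩
    have zero : ∀ {F : Set M} {ν : ℝ},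
        Tendsto (fun n => (avgOp φ ^ n) (F.indicator 1) 1) atTop (𝓝 ν) → F ⊆ Iᶜ → ν = 0 := by
      intro F ν hν hF
      refine le_antisymm (le_of_forall_pos_le_add fun ε hε => ?_)
        (ge_of_tendsto' hν fun n => le_avgOp_pow φ n fun _ => indicator_one_nonneg _ _)
      obtain ⟨m, hm⟩ := tendsto_avgOp_pow_compl_ideal hφ hI hideal hε
      rw [zero_add]
      refine le_of_tendsto hν ?_
      filter_upwards [eventually_ge_atTop m] with n hn
      exact (avgOp_pow_mono φ n fun t => Set.indicator_le_indicator_of_subset hF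
        (fun _ => zero_le_one) _).trans (hm n hn 1).le
    refine h.imp (fun h => ?_) (fun h => ?_)
    · exact zero hμ (Set.subset_compl_iff_disjoint_left.2 (Set.disjoint_iff_inter_eq_empty.2 h))
    · exact (sub_eq_zero.1 (zero hμc (Set.compl_subset_compl.2 h))).symm

end Walk

/-! ### The residual walk of a regular language -/

section Residual

variable {α : Type*} {L : Language α} {P : ℕ}

theorem length_pow (v : FreeMonoid α) (n : ℕ) : (v ^ n).length = n * v.length := by
  induction n with
  | zero => simp
  | succ n ih => rw [pow_succ, FreeMonoid.length_mul, ih, Nat.succ_mul]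

theorem exists_expand_eq (n : ℕ) (v : FreeMonoid α) (hv : v.length = P * n) :
    ∃ u, expand α P u = v := by
  induction n generalizing v with
  | zero => exact ⟨1, by rw [map_one, eq_comm, ← FreeMonoid.length_eq_zero, hv, mul_zero]⟩
  | succ n ih =>
    have hlen : (FreeMonoid.toList v).length = P * n + P := hv
    obtain ⟨u, hu⟩ := ih (FreeMonoid.ofList ((FreeMonoid.toList v).drop P)) (by
      change ((FreeMonoid.toList v).drop P).length = _
      rw [List.length_drop, hlen, Nat.add_sub_cancel])
    refine ⟨FreeMonoid.of (fun i : Fin P => (FreeMonoid.toList v)[(i : ℕ)]'(by omega)) * u, ?_⟩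
    have htake : List.ofFn (fun i : Fin P => (FreeMonoid.toList v)[(i : ℕ)]'(by omega)) =
        (FreeMonoid.toList v).take P := by
      refine List.ext_getElem (by simp [hlen]) fun i h1 h2 => ?_
      simp
    rw [map_mul, hu, expand, FreeMonoid.lift_eval_of, htake, ← FreeMonoid.ofList_append,
      List.take_append_drop, FreeMonoid.ofList_toList]

variable (hL : L.IsRegular) (hP : HasPeriod L Set.univ P) (θ : Enumeration L P) (r : ZMod P)

theorem finite_residualMonoid : Finite (residualMonoid hL hP θ r) :=
  have : Finite (Function.End (Fin (maxClassCard L P))) :=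
    inferInstanceAs (Finite (Fin (maxClassCard L P) → Fin (maxClassCard L P)))
  Finite.of_injective (fun τ => τ.1.unop) (MulOpposite.unop_injective.comp Subtype.val_injective)

theorem blockHom_surjective : Function.Surjective (blockHom hL hP θ r) := by
  rintro ⟨_, f, ⟨t, ht⟩, rfl⟩
  obtain ⟨rfl, ht0⟩ := Prod.ext_iff.1 ht
  obtain ⟨v, rfl⟩ := syntacticHom_surjective L t
  obtain ⟨n, hn⟩ := (ZMod.natCast_eq_zero_iff v.length P).1 ht0
  obtain ⟨u, rfl⟩ := exists_expand_eq n v hn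
  exact ⟨u, rfl⟩

variable {r}

theorem blockHom_eq_of_syntacticHom_eq {u v : FreeMonoid (Fin P → α)}
    (h : syntacticHom L (expand α P u) = syntacticHom L (expand α P v)) :
    blockHom hL hP θ r u = blockHom hL hP θ r v :=
  Subtype.ext (congrArg (fun t => canFun hL hP θ t r) h)

/-- `T_r` records, through `θ r`, exactly the right action of block words on `N_r`: evaluate both
transformations at the index of `s`. -/
theorem mul_syntacticHom_eq_of_blockHom_eq {u v : FreeMonoid (Fin P → α)}
    (h : blockHom hL hP θ r u = blockHom hL hP θ r v) {s : SyntacticMonoid L}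
    (hs : s ∈ residualClass L P r) :
    s * syntacticHom L (expand α P u) = s * syntacticHom L (expand α P v) := by
  have h' : canFun hL hP θ (syntacticHom L (expand α P u)) r =
      canFun hL hP θ (syntacticHom L (expand α P v)) r := congrArg Subtype.val h
  set j := (θ r).symm ⟨s, hs⟩ with hj
  have hθ : (θ r j : SyntacticMonoid L) = s := by rw [hj, Equiv.apply_symm_apply]
  have mem : ∀ u, (θ r j : SyntacticMonoid L) * syntacticHom L (expand α P u) ∈
      residualClass L P r := fun u => by
    have := mul_mem_residualClass hL hP (θ r j).2 (syntacticHom L (expand α P u))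
    rwa [residual_expand, add_zero] at this
  have happ := fun u => canFun_apply hL hP θ (syntacticHom L (expand α P u)) r r
    (by rw [residual_expand, add_zero]) (Fin.castLE (card_residualClass_le hL P r) j) j.2 (mem u)
  have h2 := (happ u).symm.trans ((congrFun (congrArg MulOpposite.unop h') _).trans (happ v))
  have h3 := congrArg Subtype.val ((θ r).symm.injective (Fin.castLE_injective _ h2))
  rwa [← hθ]

theorem toList_mem_iff_of_syntacticHom_eq {u v : FreeMonoid α}
    (h : syntacticHom L u = syntacticHom L v) :
    FreeMonoid.toList u ∈ L ↔ FreeMonoid.toList v ∈ L := by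
  have := (Con.eq (syntacticCon L)).1 h 1 1
  simpa using this

theorem blockQuotient_eq_preimage {w : List α} (hw : (w.length : ZMod P) = r) :
    blockQuotient L P w =
      {u | blockHom hL hP θ r (FreeMonoid.ofList u) ∈ blockImage hL hP θ r w} := by
  ext u
  refine ⟨fun hu => ⟨u, hu, rfl⟩, ?_⟩
  rintro ⟨v, hv, h⟩
  have := mul_syntacticHom_eq_of_blockHom_eq hL hP θ h
    (s := syntacticHom L (FreeMonoid.ofList w)) ⟨_, hw, rfl⟩
  rw [← map_mul, ← map_mul] at this
  exact (toList_mem_iff_of_syntacticHom_eq this).1 hv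

variable (r)

/-- The lengths of the block words that fix `s`. -/
def loopLengths (s : residualMonoid hL hP θ r) : AddSubmonoid ℕ where
  carrier := {n | ∃ u : FreeMonoid (Fin P → α), u.length = n ∧ s * blockHom hL hP θ r u = s}
  zero_mem' := ⟨1, FreeMonoid.length_one, by rw [map_one, mul_one]⟩
  add_mem' := by
    rintro _ _ ⟨u, rfl, hu⟩ ⟨v, rfl, hv⟩
    exact ⟨u * v, FreeMonoid.length_mul u v, by rw [map_mul, ← mul_assoc, hu, hv]⟩

variable {r}

/-- A common divisor of the lengths of the loops at a recurrent element yields a period. -/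
theorem hasPeriod_mul_of_dvd {s : residualMonoid hL hP θ r} (hs : s ∈ recurrentSet _) {d : ℕ}
    (hd : ∀ n ∈ loopLengths hL hP θ r s, d ∣ n) : HasPeriod L Set.univ (P * d) := by
  obtain ⟨⟨a, -⟩, hP0, hdvd⟩ := id hP
  refine ⟨⟨a, Set.mem_univ a⟩, Nat.mul_pos hP0 (Nat.pos_of_ne_zero ?_), ?_⟩
  · rintro rfl
    obtain ⟨z, hz⟩ := hs (blockHom hL hP θ r (FreeMonoid.of fun _ => a))
    obtain ⟨b, rfl⟩ := blockHom_surjective hL hP θ r z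
    have := hd _ ⟨FreeMonoid.of (fun _ => a) * b, rfl, by rw [map_mul, ← mul_assoc, hz]⟩
    rw [FreeMonoid.length_mul, FreeMonoid.length_of, zero_dvd_iff] at this
    omega
  · rintro w ⟨t, ht⟩
    have hw := hdvd w ⟨t, ht⟩
    rw [letterCount_univ] at hw ⊢
    obtain ⟨n, hn⟩ := hw
    obtain ⟨u, rfl⟩ := exists_expand_eq n w hn
    obtain ⟨v, rfl⟩ := syntacticHom_surjective L t
    -- The length of `v` need not be a multiple of `P`, but that of `v ^ P` is; since `0 < P`, its
    -- last factor `v` still absorbs `u`.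
    obtain ⟨x, hx⟩ := exists_expand_eq (P := P) v.length (v ^ P) (length_pow v P)
    have hxu : blockHom hL hP θ r (x * u) = blockHom hL hP θ r x := by
      apply blockHom_eq_of_syntacticHom_eq
      obtain ⟨p, rfl⟩ := Nat.exists_eq_succ_of_ne_zero hP0.ne'
      rw [map_mul, map_mul, hx, map_pow, pow_succ, mul_assoc, ht]
    obtain ⟨z, hz⟩ := hs (blockHom hL hP θ r x)
    obtain ⟨b, rfl⟩ := blockHom_surjective hL hP θ r z
    -- Two loops at `s`, with and without `u`: `d` divides both lengths, hence their difference
    -- `|u|`.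
    have h1 := hd _ ⟨x * b, rfl, by rw [map_mul, ← mul_assoc, hz]⟩
    have h2 := hd _ ⟨x * u * b, rfl, by rw [map_mul, hxu, ← mul_assoc, hz]⟩
    rw [length_expand]
    refine Nat.mul_dvd_mul_left P ((Nat.dvd_add_right h1).1 ?_)
    convert h2 using 1
    simp only [FreeMonoid.length_mul]
    ring

theorem exists_reachesIn_blockHom (hmax : IsMaxPeriod L Set.univ P) :
    ∃ N, ReachesIn (blockHom hL hP θ r) N := by
  have loc : ∀ s : residualMonoid hL hP θ r, ∀ t, ∃ N, ∀ n ≥ N, s ∈ recurrentSet _ →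
      ∃ u, u.length = n ∧ s * blockHom hL hP θ r u = s * t := by
    intro s t
    by_cases hs : s ∈ recurrentSet (residualMonoid hL hP θ r)
    swap
    · exact ⟨0, fun _ _ h => absurd h hs⟩
    obtain ⟨v, rfl⟩ := blockHom_surjective hL hP θ r t
    have hgcd : Nat.setGcd (loopLengths hL hP θ r s : Set ℕ) ∣ 1 := by
      have hper := hasPeriod_mul_of_dvd hL hP θ hs fun n hn => Nat.setGcd_dvd_of_mem hn
      have hle := hmax.2 hper
      have hpos := hper.2.1
      rw [Nat.dvd_one]
      have := Nat.le_of_mul_le_mul_left (hle.trans_eq (mul_one P).symm) hP.2.1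
      exact le_antisymm this (Nat.pos_of_mul_pos_left hpos)
    -- A submonoid of `ℕ` contains all large multiples of its gcd, here `1`. Loop at `s` for `n -
    -- v.length` letters, then read `v`.
    obtain ⟨N, hN⟩ := Nat.exists_mem_closure_of_ge (loopLengths hL hP θ r s : Set ℕ)
    refine ⟨N + v.length, fun n hn _ => ?_⟩
    have := hN (n - v.length) (by omega) (hgcd.trans (one_dvd _))
    rw [AddSubmonoid.closure_eq] at this
    obtain ⟨u, hu, hsu⟩ := this
    refine ⟨u * v, ?_, by rw [map_mul, ← mul_assoc, hsu]⟩
    rw [FreeMonoid.length_mul, hu]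
    omega
  choose N hN using loc
  have := finite_residualMonoid hL hP θ r
  -- Since `loc` gives all lengths beyond a threshold, the finitely many pairs `(s, t)` share one
  -- length.
  obtain ⟨B, hB⟩ := (Set.finite_range fun p : _ × _ => N p.1 p.2).bddAbove
  exact ⟨B, fun s hs t => hN s t B (hB ⟨(s, t), rfl⟩) hs⟩

end Residual

end PeriodicLanguage

theorem theorem4 {α : Type*} [Finite α] (L : Language α) (hL : L.IsRegular) (P : ℕ)
    (hP : IsMaxPeriod L Set.univ P) (θ : Enumeration L P)
    (r : ℕ) (hr : r < P) (w : List α) (hw : w.length = r) :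
    ∃ μ : ℝ, Tendsto (density (blockQuotient L P w)) atTop (𝓝 μ) ∧
      ((μ = 0 ∨ μ = 1) ↔
        ∃ I : Set (residualMonoid hL hP.hasPeriod θ (r : ZMod P)),
          I.Nonempty ∧ IsMonoidIdeal I ∧
          (I ∩ blockImage hL hP.hasPeriod θ (r : ZMod P) w = ∅ ∨
            I ⊆ blockImage hL hP.hasPeriod θ (r : ZMod P) w)) := by
  have := Fintype.ofFinite α
  obtain ⟨a, -⟩ := hP.hasPeriod.1
  have : Nonempty (Fin P → α) := ⟨fun _ => a⟩
  have := finite_residualMonoid hL hP.hasPeriod θ (r : ZMod P)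
  obtain ⟨N, hN⟩ := exists_reachesIn_blockHom hL hP.hasPeriod θ (r := (r : ZMod P)) hP
  rw [blockQuotient_eq_preimage hL hP.hasPeriod θ (congrArg Nat.cast hw)]
  exact tendsto_density_zero_or_one_iff (blockHom_surjective hL hP.hasPeriod θ (r : ZMod P)) hN _
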